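/- Let $(S_n)_{n\ge 0}$ be a random walk in $\mathbb{R}^3$ (in particular, possibly in $\mathbb{Z}^3$): the increments $X_n=S_{n+1}-S_n$, $n\ge 0$, are independent and identically distributed, and the sequence $(X_n)$ is independent of the starting point $S_0$. Assume that the three coordinate processes $(S_n^1)_{n\ge 0}$, $(S_n^2)_{n\ge 0}$, $(S_n^3)_{n\ge 0}$ are independent, and that the walk is truly three-dimensional in the sense that no coordinate is trivial, i.e. $P(X_0^i\neq 0)>0$ for $i=1,2,3$. Then $(S_n)$ is polygonally transient: there is no bounded set $B\subset\mathbb{R}^3$ such that almost surely the line segment joining $S_n$ and $S_{n+1}$ hits $B$ for infinitely many $n$. More precisely, for every bounded set $B\subset\mathbb{R}^3$, almost surely the line segment joining $S_n$ and $S_{n+1}$ hits $B$ for only finitely many $n$. -/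

import Mathlib

open MeasureTheory ProbabilityTheory

namespace PolygonalWalk

variable {Ω : Type*} [MeasurableSpace Ω] {d : ℕ}

/-- The `n`-th increment `S (n + 1) - S n` of a process in `ℝ^d`. -/
def increment (S : ℕ → Ω → EuclideanSpace ℝ (Fin d)) (n : ℕ) (ω : Ω) :
    EuclideanSpace ℝ (Fin d) :=
  S (n + 1) ω - S n ω

/-- `S` is a random walk in `ℝ^d` under `μ`: its increments are independent and identically
distributed, and independent of the (possibly random) starting point. Walks in `ℤ^d` are those
that take values in the integer points. -/
structure IsRandomWalk (S : ℕ → Ω → EuclideanSpace ℝ (Fin d)) (μ : Measure Ω) : Prop where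
  measurable : ∀ n, Measurable (S n)
  iIndepFun_increment : iIndepFun (fun n : ℕ => increment S n) μ
  identDistrib_increment : ∀ n, IdentDistrib (increment S n) (increment S 0) μ μ
  indepFun_start : IndepFun (S 0) (fun (ω : Ω) (n : ℕ) => increment S n ω) μ

/-- The `d` coordinate processes `(S_n^i)_{n ≥ 0}` of `S` are independent (as random sequences). -/
def IndepComponents (S : ℕ → Ω → EuclideanSpace ℝ (Fin d)) (μ : Measure Ω) : Prop :=
  iIndepFun (fun (i : Fin d) (ω : Ω) (n : ℕ) => S n ω i) μ

/-- The set of times `n` at which the segment from `S n ω` to `S (n + 1) ω` hits `B`. -/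
def hitTimes (S : ℕ → Ω → EuclideanSpace ℝ (Fin d)) (B : Set (EuclideanSpace ℝ (Fin d)))
    (ω : Ω) : Set ℕ :=
  {n | (segment ℝ (S n ω) (S (n + 1) ω) ∩ B).Nonempty}

/-- No bounded set is a.s. hit by infinitely many segments. -/
def PolygonallyTransient (S : ℕ → Ω → EuclideanSpace ℝ (Fin d)) (μ : Measure Ω) : Prop :=
  ¬ ∃ B : Set (EuclideanSpace ℝ (Fin d)), Bornology.IsBounded B ∧
    ∀ᵐ ω ∂μ, (hitTimes S B ω).Infinite

end PolygonalWalk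

namespace PolygonalWalk

/-! If the segment from $S_n$ to $S_{n+1}$ meets a ball of radius $M$ about $0$, then $|S_n^i| \le M
+ |X_n^i|$ for every $i$. These three events are independent; each has probability $O(n^{-1/2})$
unless the increments of that coordinate are constant. The product $O(n^{-3/2})$ is summable, and
Borel–Cantelli concludes. A constant nonzero increment already gives transience by linear drift.

No moments are assumed, so the window $M + |X_n^i|$ may be large. Given $X_n^i = x$ with $|x|$
large, `measure_sum_mem_Ico_le` at scale $|x|/2$ bounds the probability by a constant times $(n
H(|x|))^{-1/2}$, where $H(u) = P(|X_0^i| \ge u)$. Since $P(H(|X_0^i|) \le t) \le t$, the mean of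
$H(|X_0^i|)^{-1/2}$ is finite (`exists_lintegral_measure_abs_le`). -/

/-! ### Littlewood–Offord bounds for subset sums. -/

theorem sq_centralBinom_mul_le (n : ℕ) : n.centralBinom ^ 2 * (2 * n + 1) ≤ 16 ^ n := by
  induction n with
  | zero => simp
  | succ n ih =>
    have h := Nat.succ_mul_centralBinom_succ n
    have hpos : 0 < (n + 1) ^ 2 := by positivity
    refine Nat.le_of_mul_le_mul_left ?_ hpos
    calc (n + 1) ^ 2 * ((n + 1).centralBinom ^ 2 * (2 * (n + 1) + 1))
        = ((n + 1) * (n + 1).centralBinom) ^ 2 * (2 * n + 3) := by ring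
      _ = (n.centralBinom ^ 2 * (2 * n + 1)) * (4 * ((2 * n + 1) * (2 * n + 3))) := by
          rw [h]; ring
      _ ≤ 16 ^ n * (4 * ((2 * n + 1) * (2 * n + 3))) := Nat.mul_le_mul_right _ ih
      _ ≤ 16 ^ n * (16 * (n + 1) ^ 2) := Nat.mul_le_mul_left _ (by nlinarith)
      _ = (n + 1) ^ 2 * 16 ^ (n + 1) := by ring

theorem sq_choose_half_mul_le (m : ℕ) : (m.choose (m / 2)) ^ 2 * (m + 1) ≤ 4 ^ m := by
  rcases Nat.even_or_odd' m with ⟨k, rfl | rfl⟩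
  · have h := sq_centralBinom_mul_le k
    rw [Nat.centralBinom_eq_two_mul_choose] at h
    rw [Nat.mul_div_cancel_left k two_pos, pow_mul]
    norm_num
    exact h
  · have h := sq_centralBinom_mul_le (k + 1)
    have e : (k + 1).centralBinom = 2 * (2 * k + 1).choose k := by
      rw [Nat.centralBinom_eq_two_mul_choose]
      have h1 : 2 * (k + 1) = (2 * k + 1) + 1 := by ring
      rw [h1, Nat.choose_succ_succ, Nat.choose_symm_half]
      ring
    rw [e] at h
    have h2 : (2 * k + 1) / 2 = k := by omega
    rw [h2]
    have h3 : 4 ^ (2 * k + 1) = 4 * 16 ^ k := by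
      rw [pow_succ, pow_mul]; norm_num [mul_comm]
    rw [h3]
    have h4 : 16 ^ (k + 1) = 16 * 16 ^ k := by ring
    rw [h4] at h
    nlinarith [Nat.zero_le ((2 * k + 1).choose k ^ 2)]

open Finset in
/-- The Littlewood–Offord bound of Erdős: few subset sums of numbers of modulus at least `l` lie
in a half-open interval of length `l`. -/
theorem card_subset_sums_le {α : Type*} [Fintype α] [DecidableEq α] (y : α → ℝ) {l : ℝ}
    (hy : ∀ j, l ≤ |y j|) (a : ℝ) :
    #{A : Finset α | a ≤ ∑ j ∈ A, y j ∧ ∑ j ∈ A, y j < a + l} ≤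
      (Fintype.card α).choose (Fintype.card α / 2) := by
  -- Taking the symmetric difference with `D` turns every `y j` into `|y j|`, up to a constant. A
  -- strictly larger set then has a sum larger by at least `l`, so the family is an antichain and
  -- Sperner's theorem applies.
  set D : Finset α := {j | y j < 0} with hD
  set F : Finset (Finset α) := {A : Finset α | a ≤ ∑ j ∈ A, y j ∧ ∑ j ∈ A, y j < a + l} with hF
  have hinj : Function.Injective (fun A : Finset α => symmDiff A D) :=
    symmDiff_left_injective D
  rw [← card_image_of_injective F hinj]
  apply IsAntichain.sperner
  have key : ∀ A : Finset α, ∑ j ∈ A, y j = ∑ j ∈ symmDiff A D, |y j| + ∑ j ∈ D, y j := by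
    intro A
    have h1 : ∀ B : Finset α, ∀ f : α → ℝ, ∑ j ∈ B, f j = ∑ j, if j ∈ B then f j else 0 := by
      intro B f; simp
    rw [h1 A, h1 (symmDiff A D), h1 D, ← sum_add_distrib]
    refine sum_congr rfl fun j _ => ?_
    simp only [mem_symmDiff, hD, mem_filter, mem_univ, true_and]
    rcases lt_or_ge (y j) 0 with h | h
    · by_cases hA : j ∈ A <;> simp [hA, h, abs_of_neg]
    · by_cases hA : j ∈ A <;> simp [hA, h, not_lt.2 h, abs_of_nonneg]
  intro U hU V hV hne hUV
  simp only [coe_image, Set.mem_image, mem_coe] at hU hV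
  obtain ⟨A, hA, rfl⟩ := hU
  obtain ⟨B, hB, rfl⟩ := hV
  simp only [hF, mem_filter, mem_univ, true_and] at hA hB
  rw [key A, key B] at *
  have hss : symmDiff A D ⊂ symmDiff B D := lt_of_le_of_ne hUV hne
  obtain ⟨i, hiB, hiA⟩ := exists_of_ssubset hss
  have h2 : |y i| + ∑ j ∈ symmDiff A D, |y j| ≤ ∑ j ∈ symmDiff B D, |y j| := by
    rw [← sum_insert (f := fun j => |y j|) hiA]
    exact sum_le_sum_of_subset_of_nonneg (insert_subset hiB hUV) fun _ _ _ => abs_nonneg _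
  linarith [hy i, hA.1, hB.2]

open Finset in
theorem card_subset_sums_le_of_large {ι : Type*} [Fintype ι] [DecidableEq ι] (y : ι → ℝ)
    (l a : ℝ) :
    (#{A : Finset ι | a ≤ ∑ j ∈ A, y j ∧ ∑ j ∈ A, y j < a + l} : ℝ) ≤
      2 ^ Fintype.card ι / √((#{j | l ≤ |y j|} : ℝ) + 1) := by
  set J : Finset ι := {j | l ≤ |y j|} with hJ
  set m := #J with hm
  have hmc : Fintype.card J = m := by simp [hm]
  set F : Finset (Finset ι) := {A : Finset ι | a ≤ ∑ j ∈ A, y j ∧ ∑ j ∈ A, y j < a + l} with hF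
  -- Fixing the part of `A` outside `J` only shifts `a`; what remains is a subset of `J`, where all
  -- terms are large.
  have hfib : ∀ B ∈ Jᶜ.powerset, #{A ∈ F | A \ J = B} ≤ m.choose (m / 2) := by
    intro B hB
    have h := card_subset_sums_le (α := J) (fun j => y j) (l := l)
      (fun j => (mem_filter.1 j.2).2) (a - ∑ j ∈ B, y j)
    rw [hmc] at h
    refine le_trans ?_ h
    refine card_le_card_of_injOn (fun A => A.subtype (· ∈ J)) ?_ ?_
    · intro A hA
      simp only [hF, coe_filter, mem_filter, mem_univ, true_and, Set.mem_ofPred_eq] at hA ⊢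
      obtain ⟨hA1, rfl⟩ := hA
      have hs : ∑ j ∈ A.subtype (· ∈ J), y j = ∑ j ∈ A ∩ J, y j := by
        rw [Finset.sum_subtype_eq_sum_filter, filter_mem_eq_inter]
      have hs2 := sum_inter_add_sum_sdiff A J y
      rw [hs]
      constructor <;> linarith [hA1.1, hA1.2]
    · intro A hA A' hA' hAA
      simp only [coe_filter, Set.mem_ofPred_eq] at hA hA'
      have e1 : A \ J = A' \ J := hA.2.trans hA'.2.symm
      ext j
      by_cases hj : j ∈ J
      · have := congrArg (fun s : Finset J => (⟨j, hj⟩ : J) ∈ s) hAA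
        simpa using this
      · have := congrArg (fun s : Finset ι => j ∈ s) e1
        simpa [hj] using this
  have hcard : #F ≤ #Jᶜ.powerset * m.choose (m / 2) := by
    rw [mul_comm]
    refine card_le_mul_card_image_of_maps_to (f := fun A => A \ J) ?_ _ hfib
    intro A _
    rw [mem_powerset]
    intro j hj
    simp only [mem_sdiff] at hj
    simpa using hj.2
  rw [card_powerset, card_compl, ← hm] at hcard
  have hmle : m ≤ Fintype.card ι := card_le_univ J
  have hch : (m.choose (m / 2) : ℝ) ≤ 2 ^ m / √((m : ℝ) + 1) := by
    rw [le_div_iff₀ (by positivity)]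
    refine abs_le_of_sq_le_sq' ?_ (by positivity) |>.2
    rw [mul_pow, Real.sq_sqrt (by positivity), ← pow_mul, mul_comm m 2, pow_mul]
    have := sq_choose_half_mul_le m
    norm_num
    exact_mod_cast this
  calc (#F : ℝ) ≤ 2 ^ (Fintype.card ι - m) * (m.choose (m / 2) : ℝ) := by exact_mod_cast hcard
    _ ≤ 2 ^ (Fintype.card ι - m) * (2 ^ m / √((m : ℝ) + 1)) := by gcongr
    _ = 2 ^ Fintype.card ι / √((m : ℝ) + 1) := by
        rw [← mul_div_assoc, ← pow_add, Nat.sub_add_cancel hmle]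

/-! ### Concentration of i.i.d. sums by symmetrization. -/

open Finset in
/-- If `N` is the number of successes in `n` independent trials of success probability `q`, then
`E[1 / (N + 1)] ≤ 1 / ((n + 1) q)`. -/
theorem integral_one_div_count_add_one_le {α : Type*} [MeasurableSpace α] (ρ : Measure α)
    [IsProbabilityMeasure ρ] {s : Set α} (hs : MeasurableSet s) (n : ℕ) :
    ((n : ℝ) + 1) * (ρ.real s *
      ∫ w, 1 / ((∑ j, s.indicator 1 (w j) : ℝ) + 1) ∂(Measure.pi fun _ : Fin n => ρ)) ≤ 1 := by
  have h0 : ∀ x, (0 : ℝ) ≤ s.indicator 1 x := fun x => Set.indicator_nonneg (by simp) x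
  have hm : Measurable (s.indicator (1 : α → ℝ)) := measurable_one.indicator hs
  -- With one extra trial, each successful `i` contributes one over the total number of successes,
  -- so the `g i` sum to at most 1; by symmetry they have equal integrals.
  set g : Fin (n + 1) → (Fin (n + 1) → α) → ℝ := fun i w =>
    s.indicator 1 (w i) * (1 / ((∑ j, s.indicator 1 (w (i.succAbove j)) : ℝ) + 1)) with hg
  have hint : ∀ i, ∫ w, g i w ∂(Measure.pi fun _ : Fin (n + 1) => ρ) = ρ.real s *
      ∫ w, 1 / ((∑ j, s.indicator 1 (w j) : ℝ) + 1) ∂(Measure.pi fun _ : Fin n => ρ) := by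
    intro i
    have h := (measurePreserving_piFinSuccAbove (fun _ : Fin (n + 1) => ρ) i).integral_comp'
      (fun z : α × (Fin n → α) => s.indicator (1 : α → ℝ) z.1 * (1 / ((∑ j, s.indicator 1 (z.2 j) : ℝ) + 1)))
    rw [integral_prod_mul (s.indicator (1 : α → ℝ))
      (fun z : Fin n → α => 1 / ((∑ j, s.indicator 1 (z j) : ℝ) + 1)), integral_indicator_one hs] at h
    rw [← h]
    rfl
  have hgm : ∀ i, Measurable (g i) := by
    intro i
    refine (hm.comp (measurable_pi_apply i)).mul (measurable_const.div (Measurable.add_const ?_ _))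
    exact Finset.measurable_sum _ fun j _ => hm.comp (measurable_pi_apply _)
  have hsum : ∀ w, ∑ i, g i w ≤ 1 := by
    intro w
    have hle : ∀ i, g i w ≤ s.indicator 1 (w i) * (1 / ∑ j, s.indicator (1 : α → ℝ) (w j)) := by
      intro i
      by_cases hi : w i ∈ s
      · simp [hg, hi, Fin.sum_univ_succAbove _ i, add_comm]
      · simp [hg, hi]
    refine (sum_le_sum fun i _ => hle i).trans ?_
    rw [← sum_mul, mul_one_div]
    exact div_self_le_one _
  have hgi : ∀ i, Integrable (g i) (Measure.pi fun _ : Fin (n + 1) => ρ) := by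
    intro i
    refine Integrable.of_bound (hgm i).aestronglyMeasurable 1 (Filter.Eventually.of_forall ?_)
    intro w
    have hnn : ∀ i, 0 ≤ g i w := fun i => mul_nonneg (h0 _)
      (div_nonneg zero_le_one (add_nonneg (sum_nonneg fun j _ => h0 _) zero_le_one))
    rw [Real.norm_of_nonneg (hnn i)]
    exact (single_le_sum (fun i _ => hnn i) (mem_univ i)).trans (hsum w)
  have h1 : ∫ w, ∑ i, g i w ∂(Measure.pi fun _ : Fin (n + 1) => ρ) ≤ 1 := by
    calc _ ≤ ∫ w, (1 : ℝ) ∂(Measure.pi fun _ : Fin (n + 1) => ρ) :=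
          integral_mono (integrable_finsetSum _ fun i _ => hgi i) (integrable_const _) hsum
      _ = 1 := by simp
  rw [integral_finsetSum _ fun i _ => hgi i] at h1
  simpa [hint] using h1

open Finset in
/-- A form of the Kolmogorov–Rogozin concentration inequality for sums of i.i.d. variables. -/
theorem measure_sum_mem_Ico_le (ν : Measure ℝ) [IsProbabilityMeasure ν] {l q : ℝ}
    (hq0 : 0 < q) (hq : q ≤ (ν.prod ν).real {p | l ≤ |p.1 - p.2|}) (n : ℕ) (a : ℝ) :
    (Measure.pi fun _ : Fin n => ν).real {x | ∑ j, x j ∈ Set.Ico a (a + l)} ≤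
      1 / √(((n : ℝ) + 1) * q) := by
  set s : Set (ℝ × ℝ) := {p | l ≤ |p.1 - p.2|} with hs
  have hsm : MeasurableSet s := measurableSet_le measurable_const (by fun_prop)
  set P := Measure.pi fun _ : Fin n => ν.prod ν with hP
  set I : Set (Fin n → ℝ) := {x | ∑ j, x j ∈ Set.Ico a (a + l)} with hI
  have hIm : MeasurableSet I :=
    measurableSet_Ico.preimage (Finset.measurable_sum _ fun j _ => measurable_pi_apply j)
  -- Every selection of one entry from each pair has the law of the original sample, so the
  -- probability may be averaged over all `A`. For fixed pairs this average is a subset-sum count.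
  set sel : Finset (Fin n) → (Fin n → ℝ × ℝ) → Fin n → ℝ :=
    fun A w j => if j ∈ A then (w j).1 else (w j).2 with hsel
  have hmp : ∀ A, MeasurePreserving (sel A) P (Measure.pi fun _ : Fin n => ν) := by
    intro A
    refine measurePreserving_pi (fun _ => ν.prod ν) (fun _ => ν)
      (f := fun j (p : ℝ × ℝ) => if j ∈ A then p.1 else p.2) fun j => ?_
    by_cases hj : j ∈ A
    · simpa [hj] using measurePreserving_fst (μ := ν) (ν := ν)
    · simpa [hj] using measurePreserving_snd (μ := ν) (ν := ν)
  have hA : ∀ A, (Measure.pi fun _ : Fin n => ν).real I = P.real (sel A ⁻¹' I) := by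
    intro A
    rw [measureReal_def, measureReal_def, (hmp A).measure_preimage hIm.nullMeasurableSet]
  set N : (Fin n → ℝ × ℝ) → ℝ := fun w => ∑ j, s.indicator 1 (w j) with hN
  have hN0 : ∀ w, 0 ≤ N w := fun w => sum_nonneg fun j _ => Set.indicator_nonneg (by simp) _
  have hNm : Measurable N := Finset.measurable_sum _ fun j _ =>
    (measurable_one.indicator hsm).comp (measurable_pi_apply j)
  have hpt : ∀ w, ∑ A : Finset (Fin n), (sel A ⁻¹' I).indicator (1 : (Fin n → ℝ × ℝ) → ℝ) w ≤
      2 ^ n / √(N w + 1) := by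
    intro w
    classical
    have h := card_subset_sums_le_of_large (fun j => (w j).1 - (w j).2) l (a - ∑ j, (w j).2)
    have e1 : ((#{j | l ≤ |(w j).1 - (w j).2|} : ℕ) : ℝ) = N w := by
      simp [hN, hs, Set.indicator_apply]
    rw [e1, Fintype.card_fin] at h
    refine le_trans (le_of_eq ?_) h
    rw [natCast_card_filter]
    refine sum_congr rfl fun A _ => ?_
    have e2 : ∑ j, sel A w j = ∑ j, (w j).2 + ∑ j ∈ A, ((w j).1 - (w j).2) := by
      have h1 : ∑ j ∈ A, ((w j).1 - (w j).2) =
        ∑ j, if j ∈ A then ((w j).1 - (w j).2) else 0 := by simp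
      rw [h1, ← sum_add_distrib]
      refine sum_congr rfl fun j _ => ?_
      by_cases hj : j ∈ A <;> simp [hsel, hj]
    rw [Set.indicator_apply]
    refine if_congr ?_ rfl rfl
    simp only [hI, Set.mem_preimage, Set.mem_ofPred_eq, Set.mem_Ico, e2]
    constructor <;> rintro ⟨h1, h2⟩ <;> constructor <;> linarith
  have hE := integral_one_div_count_add_one_le (ν.prod ν) hsm n
  have hint1 : Integrable (fun w => 1 / (N w + 1)) P := by
    refine Integrable.of_bound (measurable_const.div (hNm.add_const _)).aestronglyMeasurable 1
      (Filter.Eventually.of_forall fun w => ?_)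
    rw [Real.norm_of_nonneg (div_nonneg zero_le_one (by linarith [hN0 w])),
      div_le_one (by linarith [hN0 w])]
    linarith [hN0 w]
  set v := ((n : ℝ) + 1) * q with hv
  have hv0 : 0 < v := by positivity
  have hE' : ∫ w, 1 / (N w + 1) ∂P ≤ 1 / v := by
    rw [le_div_iff₀ hv0]
    have h0 : 0 ≤ ∫ w, 1 / (N w + 1) ∂P :=
      integral_nonneg fun w => div_nonneg zero_le_one (by linarith [hN0 w])
    calc (∫ w, 1 / (N w + 1) ∂P) * v ≤
        (∫ w, 1 / (N w + 1) ∂P) * (((n : ℝ) + 1) * (ν.prod ν).real s) := by rw [hv]; gcongr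
      _ ≤ 1 := by rw [mul_comm, mul_assoc]; exact hE
  set t := √v with ht
  have ht0 : 0 < t := Real.sqrt_pos.2 hv0
  have htt : t ^ 2 = v := Real.sq_sqrt hv0.le
  -- AM–GM reduces the mean of $(N+1)^{-1/2}$ to that of $(N+1)^{-1}$; the choice $t = \sqrt v$
  -- balances the two terms.
  have hamgm : ∀ w, 1 / √(N w + 1) ≤ (1 / t + t * (1 / (N w + 1))) / 2 := by
    intro w
    set r := √(N w + 1) with hr
    have hr0 : 0 < r := Real.sqrt_pos.2 (by linarith [hN0 w])
    have hrr : N w + 1 = r ^ 2 := (Real.sq_sqrt (by linarith [hN0 w])).symm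
    rw [hrr]
    have : (1 / t + t * (1 / r ^ 2)) / 2 - 1 / r = (r - t) ^ 2 / (2 * t * r ^ 2) := by
      field_simp; ring
    have h2 : 0 ≤ (r - t) ^ 2 / (2 * t * r ^ 2) := by positivity
    linarith
  have hone : Integrable (1 : (Fin n → ℝ × ℝ) → ℝ) P := integrable_const 1
  have hmain : (2 : ℝ) ^ n * (Measure.pi fun _ : Fin n => ν).real I ≤ 2 ^ n * (1 / t) := by
    calc (2 : ℝ) ^ n * (Measure.pi fun _ : Fin n => ν).real I
        = ∑ A : Finset (Fin n), P.real (sel A ⁻¹' I) := by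
          rw [← sum_congr rfl fun A _ => hA A]; simp
      _ = ∫ w, ∑ A : Finset (Fin n), (sel A ⁻¹' I).indicator (1 : (Fin n → ℝ × ℝ) → ℝ) w ∂P := by
          rw [integral_finsetSum _ fun A _ => hone.indicator
            ((hmp A).measurable hIm)]
          exact sum_congr rfl fun A _ => (integral_indicator_one ((hmp A).measurable hIm)).symm
      _ ≤ ∫ w, 2 ^ n * ((1 / t + t * (1 / (N w + 1))) / 2) ∂P := by
          refine integral_mono (integrable_finsetSum _ fun A _ =>
            hone.indicator ((hmp A).measurable hIm))
            (((integrable_const _).add (hint1.const_mul t)).div_const 2 |>.const_mul _) fun w => ?_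
          refine (hpt w).trans ?_
          rw [div_eq_mul_one_div]
          exact mul_le_mul_of_nonneg_left (hamgm w) (by positivity)
      _ = 2 ^ n * ((1 / t + t * ∫ w, 1 / (N w + 1) ∂P) / 2) := by
          rw [integral_const_mul, integral_div, integral_add (integrable_const _)
            (hint1.const_mul t), integral_const_mul]
          simp
      _ ≤ 2 ^ n * ((1 / t + t * (1 / v)) / 2) := by gcongr
      _ = 2 ^ n * (1 / t) := by
          rw [← htt]; field_simp; ring
  exact le_of_mul_le_mul_left hmain (by positivity)

theorem measure_sum_mem_Ico_nsmul_le (ν : Measure ℝ) [IsProbabilityMeasure ν] {l q : ℝ}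
    (hq0 : 0 < q) (hq : q ≤ (ν.prod ν).real {p | l ≤ |p.1 - p.2|}) (n k : ℕ)
    (a : ℝ) :
    (Measure.pi fun _ : Fin n => ν).real {x | ∑ j, x j ∈ Set.Ico a (a + k * l)} ≤
      k / √(((n : ℝ) + 1) * q) := by
  induction k with
  | zero => simp
  | succ k ih =>
    have h := measure_sum_mem_Ico_le ν hq0 hq n (a + k * l)
    have hsub : {x : Fin n → ℝ | ∑ j, x j ∈ Set.Ico a (a + (k + 1 : ℕ) * l)} ⊆
        {x | ∑ j, x j ∈ Set.Ico a (a + k * l)} ∪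
          {x | ∑ j, x j ∈ Set.Ico (a + k * l) (a + k * l + l)} := by
      rintro x ⟨h1, h2⟩
      push_cast at h2
      rcases lt_or_ge (∑ j, x j) (a + k * l) with h3 | h3
      · exact Or.inl ⟨h1, h3⟩
      · exact Or.inr ⟨h3, by linarith⟩
    calc _ ≤ _ := measureReal_mono hsub
      _ ≤ _ := measureReal_union_le _ _
      _ ≤ k / √(((n : ℝ) + 1) * q) + 1 / √(((n : ℝ) + 1) * q) := add_le_add ih h
      _ = _ := by push_cast; ring

/-! ### Windows as wide as the next step. -/

theorem measurableSet_setOf_measure_Ici_le (ρ : Measure ℝ) (t : ENNReal) :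
    MeasurableSet {y | ρ (Set.Ici y) ≤ t} := by
  have : IsUpperSet {y | ρ (Set.Ici y) ≤ t} := fun y z hyz hy =>
    (measure_mono (Set.Ici_subset_Ici.2 hyz)).trans hy
  exact this.ordConnected.measurableSet

/-- A compact subset contains its minimum, hence lies in a half-line of mass at most `t`; inner
regularity passes to the whole set, whether or not its infimum is attained. -/
theorem measure_setOf_measure_Ici_le (ρ : Measure ℝ) [IsFiniteMeasure ρ] (t : ENNReal) :
    ρ {y | ρ (Set.Ici y) ≤ t} ≤ t := by
  rw [(measurableSet_setOf_measure_Ici_le ρ t).measure_eq_iSup_isCompact]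
  refine iSup_le fun K => iSup_le fun hKU => iSup_le fun hK => ?_
  rcases K.eq_empty_or_nonempty with rfl | hne
  · simp
  · have h1 : sInf K ∈ K := hK.sInf_mem hne
    exact (measure_mono fun y hy => csInf_le hK.bddBelow hy).trans (hKU h1)

/-- Otherwise two independent copies agree almost surely, and Fubini makes the law a point mass. -/
theorem exists_pos_measure_le_abs_sub (ν : Measure ℝ) [IsProbabilityMeasure ν]
    (hν : ∀ c, ¬ ∀ᵐ x ∂ν, x = c) :
    ∃ l > 0, 0 < (ν.prod ν).real {p | l ≤ |p.1 - p.2|} := by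
  by_contra! hcon
  have h0 : ∀ k : ℕ, (ν.prod ν) {p | 1 / ((k : ℝ) + 1) ≤ |p.1 - p.2|} = 0 := by
    intro k
    have := (hcon (1 / ((k : ℝ) + 1)) (by positivity)).antisymm measureReal_nonneg
    rwa [measureReal_eq_zero_iff] at this
  have h1 : ∀ᵐ p ∂(ν.prod ν), p.2 = p.1 := by
    have h2 := measure_iUnion_null h0
    refine measure_mono_null ?_ h2
    intro p hp
    have hp' : 0 < |p.1 - p.2| := abs_pos.2 (sub_ne_zero.2 fun h => hp h.symm)
    obtain ⟨k, hk⟩ := exists_nat_one_div_lt hp'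
    exact Set.mem_iUnion.2 ⟨k, hk.le⟩
  obtain ⟨c, hc⟩ := (Measure.ae_ae_of_ae_prod h1).exists
  exact hν c hc

theorem exists_half_le_measure_abs_le (ν : Measure ℝ) [IsProbabilityMeasure ν] :
    ∃ m : ℝ, 0 < m ∧ 1 / 2 ≤ ν.real {x | |x| ≤ m} := by
  have hmono : Monotone fun k : ℕ => {x : ℝ | |x| ≤ k} := fun a b hab x hx =>
    le_trans (show |x| ≤ a from hx) (by exact_mod_cast hab)
  have ht := tendsto_measure_iUnion_atTop (μ := ν) hmono
  have hU : (⋃ k : ℕ, {x : ℝ | |x| ≤ k}) = Set.univ :=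
    Set.eq_univ_of_forall fun x => Set.mem_iUnion.2 (exists_nat_ge |x|)
  rw [hU, measure_univ] at ht
  have ht' := (ENNReal.tendsto_toReal ENNReal.one_ne_top).comp ht
  have hev := ht'.eventually (lt_mem_nhds (show (1 / 2 : ℝ) < (1 : ENNReal).toReal by norm_num))
  obtain ⟨k, hk, hk0⟩ := (hev.and (Filter.eventually_gt_atTop 0)).exists
  exact ⟨k, by exact_mod_cast hk0, le_of_lt hk⟩

/-- For i.i.d. non-constant real steps, the probability that the walk is, before its step number
`n`, within a distance from a given point that the step can bridge is `O(1 / √n)`. -/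
theorem exists_lintegral_measure_abs_le (ν : Measure ℝ) [IsProbabilityMeasure ν]
    (hν : ∀ c, ¬ ∀ᵐ x ∂ν, x = c) (M : ℝ) :
    ∃ C : ℝ, 0 ≤ C ∧ ∀ (n : ℕ) (s : ℝ),
      ∫⁻ x, (Measure.pi fun _ : Fin n => ν) {y | |s + ∑ j, y j| ≤ M + |x|} ∂ν ≤
        ENNReal.ofReal (C / √((n : ℝ) + 1)) := by
  obtain ⟨l, hl, hql⟩ := exists_pos_measure_le_abs_sub ν hν
  obtain ⟨m, hm, hmν⟩ := exists_half_le_measure_abs_le ν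
  set q := (ν.prod ν).real {p | l ≤ |p.1 - p.2|} with hq
  set x₀ := max M (2 * m) with hx₀
  obtain ⟨K, hK⟩ := exists_nat_gt (4 * x₀ / l)
  rw [div_lt_iff₀ hl] at hK
  set ρ := ν.map (fun x => |x|) with hρ
  have hab : Measurable fun x : ℝ => |x| := by fun_prop
  have : IsProbabilityMeasure ρ := Measure.isProbabilityMeasure_map hab.aemeasurable
  set U : ℝ → Set ℝ := fun t => {x | ρ (Set.Ici |x|) ≤ ENNReal.ofReal t} with hU
  have hUm : ∀ t, MeasurableSet (U t) := fun t =>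
    hab (measurableSet_setOf_measure_Ici_le ρ (ENNReal.ofReal t))
  have hUle : ∀ t, ν (U t) ≤ ENNReal.ofReal t := by
    intro t
    have h := measure_setOf_measure_Ici_le ρ (ENNReal.ofReal t)
    rwa [hρ, Measure.map_apply hab (measurableSet_setOf_measure_Ici_le _ _)] at h
  refine ⟨K / √q + 72, by positivity, fun n s => ?_⟩
  have hn : (0 : ℝ) < n + 1 := by positivity
  set P := Measure.pi fun _ : Fin n => ν with hP
  set r := √((n : ℝ) + 1) with hr
  have hr0 : 0 < r := Real.sqrt_pos.2 hn
  -- A positive tail is needed to place it between consecutive powers of 1/4.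
  have hpos : ∀ᵐ x ∂ν, 0 < ρ.real (Set.Ici |x|) := by
    have h0 : ν (U 0) = 0 := by simpa using hUle 0
    filter_upwards [measure_eq_zero_iff_ae_notMem.1 h0] with x hx
    simp only [hU, Set.mem_ofPred_eq, ENNReal.ofReal_zero, not_le] at hx
    exact ENNReal.toReal_pos hx.ne' (measure_ne_top _ _)
  have hbound : ∀ᵐ x ∂ν, P {y | |s + ∑ j, y j| ≤ M + |x|} ≤
      ENNReal.ofReal (K / √q / r) +
        ∑' k : ℕ, (U ((1 / 4) ^ k)).indicator (fun _ => ENNReal.ofReal (36 * 2 ^ k / r)) x := by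
    filter_upwards [hpos] with x hx
    rcases lt_or_ge |x| x₀ with hlt | hge
    · refine le_trans ?_ le_self_add
      rw [← ofReal_measureReal]
      refine ENNReal.ofReal_le_ofReal ?_
      have h := measure_sum_mem_Ico_nsmul_le ν hql le_rfl n K (-s - 2 * x₀)
      rw [Real.sqrt_mul hn.le, mul_comm √_ √q, ← div_div] at h
      refine le_trans (measureReal_mono ?_) h
      intro y hy
      have hy' := abs_le.1 (show |s + ∑ j, y j| ≤ M + |x| from hy)
      have hMx : M ≤ x₀ := le_max_left _ _
      exact ⟨by linarith [hy'.1], by linarith [hy'.2]⟩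
    · refine le_trans ?_ le_add_self
      set H := ρ.real (Set.Ici |x|) with hH
      have hH1 : H ≤ 1 := measureReal_le_one
      obtain ⟨k, hk1, hk2⟩ := exists_nat_pow_near_of_lt_one hx hH1
        (show (0 : ℝ) < 1 / 4 by norm_num) (show (1 / 4 : ℝ) < 1 by norm_num)
      have hxk : x ∈ U ((1 / 4) ^ k) := by
        simp only [hU, Set.mem_ofPred_eq]
        rw [← ofReal_measureReal]
        exact ENNReal.ofReal_le_ofReal hk2
      refine le_trans ?_ (ENNReal.le_tsum k)
      rw [Set.indicator_of_mem hxk, ← ofReal_measureReal]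
      refine ENNReal.ofReal_le_ofReal ?_
      have hmx : 2 * m ≤ |x| := (le_max_right _ _).trans hge
      have hMx : M ≤ |x| := (le_max_left _ _).trans hge
      have hHν : H = ν.real {y | |x| ≤ |y|} := by
        rw [hH, measureReal_def, hρ, Measure.map_apply hab measurableSet_Ici]; rfl
      -- One copy exceeds `|x|` in modulus and the other stays below `m ≤ |x| / 2`. The lossy factor
      -- 1/4 makes the bound a perfect square.
      have hqx : ((1 / 2 : ℝ) ^ (k + 2)) ^ 2 ≤
          (ν.prod ν).real {p | |x| / 2 ≤ |p.1 - p.2|} := by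
        calc ((1 / 2 : ℝ) ^ (k + 2)) ^ 2 = (1 / 4) ^ (k + 1) * (1 / 4) := by
              rw [← pow_mul, mul_comm, pow_mul, ← pow_succ]; norm_num
          _ ≤ H * (1 / 2) := by gcongr; norm_num
          _ ≤ ν.real {y | |x| ≤ |y|} * ν.real {y | |y| ≤ m} := by
              rw [hHν]; gcongr
          _ = (ν.prod ν).real ({y | |x| ≤ |y|} ×ˢ {y | |y| ≤ m}) := by
              simp [measureReal_def, Measure.prod_prod]
          _ ≤ _ := by
              refine measureReal_mono ?_
              rintro ⟨y, z⟩ ⟨hy, hz⟩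
              have hy' : |x| ≤ |y| := hy
              have hz' : |z| ≤ m := hz
              have := abs_sub_abs_le_abs_sub y z
              show |x| / 2 ≤ |y - z|
              linarith
      -- Eight pieces of length `|x| / 2` cover the width `4 * |x|`; the ninth takes in the closed
      -- right endpoint. The square root gives `9 * 2 ^ (k + 2) = 36 * 2 ^ k`.
      have h := measure_sum_mem_Ico_nsmul_le ν (by positivity) hqx n 9 (-s - 2 * |x|)
      refine le_trans (measureReal_mono ?_) (h.trans (le_of_eq ?_))
      · intro y hy
        have hy' := abs_le.1 (show |s + ∑ j, y j| ≤ M + |x| from hy)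
        refine ⟨by linarith [hy'.1], ?_⟩
        push_cast
        linarith [hy'.2]
      · rw [Real.sqrt_mul hn.le, Real.sqrt_sq (by positivity), one_div_pow]
        field_simp
        push_cast
        ring
  calc _ ≤ _ := lintegral_mono_ae hbound
    _ = ENNReal.ofReal (K / √q / r) +
        ∑' k : ℕ, ENNReal.ofReal (36 * 2 ^ k / r) * ν (U ((1 / 4) ^ k)) := by
        rw [lintegral_add_left measurable_const, lintegral_tsum fun k =>
          (measurable_const.indicator (hUm _)).aemeasurable]
        simp [lintegral_indicator_const (hUm _)]
    -- The set at level `k` has mass at most $4^{-k}$, which beats the factor $2^k$; the geometric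
    -- sum is 72.
    _ ≤ ENNReal.ofReal (K / √q / r) +
        ∑' k : ℕ, ENNReal.ofReal (36 / r * (1 / 2) ^ k) := by
        gcongr with k
        refine (mul_le_mul_right (hUle _) _).trans (le_of_eq ?_)
        rw [← ENNReal.ofReal_mul (by positivity)]
        congr 1
        have : (1 / 2 : ℝ) ^ k = 2 ^ k * (1 / 4) ^ k := by rw [← mul_pow]; norm_num
        rw [this]; ring
    _ = ENNReal.ofReal ((K / √q + 72) / r) := by
        rw [← ENNReal.ofReal_tsum_of_nonneg (fun k => by positivity)
          (summable_geometric_two.mul_left _), tsum_mul_left, tsum_geometric_two,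
          ← ENNReal.ofReal_add (by positivity) (by positivity)]
        congr 1; ring

/-! ### Application to the walk and Borel–Cantelli. -/

theorem exists_measure_abs_add_sum_le {Ω : Type*} [MeasurableSpace Ω] (μ : Measure Ω)
    [IsProbabilityMeasure μ] {Y : Ω → ℝ} {X : ℕ → Ω → ℝ} (hY : Measurable Y)
    (hX : ∀ n, Measurable (X n)) (hXi : iIndepFun X μ)
    (hXd : ∀ n, IdentDistrib (X n) (X 0) μ μ) (hYX : IndepFun Y (fun ω n => X n ω) μ)
    (hX0 : ∀ c, ¬ ∀ᵐ ω ∂μ, X 0 ω = c) (M : ℝ) :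
    ∃ C : ℝ, 0 ≤ C ∧ ∀ n : ℕ,
      μ {ω | |Y ω + ∑ j ∈ Finset.range n, X j ω| ≤ M + |X n ω|} ≤
        ENNReal.ofReal (C / √((n : ℝ) + 1)) := by
  set ν := μ.map (X 0) with hν
  have : IsProbabilityMeasure ν := Measure.isProbabilityMeasure_map (hX 0).aemeasurable
  have hνc : ∀ c, ¬ ∀ᵐ x ∂ν, x = c := by
    intro c h
    exact hX0 c (ae_of_ae_map (hX 0).aemeasurable h)
  obtain ⟨C, hC0, hC⟩ := exists_lintegral_measure_abs_le ν hνc M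
  refine ⟨C, hC0, fun n => ?_⟩
  set Z : Ω → Fin (n + 1) → ℝ := fun ω j => X j ω with hZ
  have hZm : Measurable Z := measurable_pi_lambda _ fun j => hX j
  have hZlaw : μ.map Z = Measure.pi fun _ : Fin (n + 1) => ν := by
    have h1 : iIndepFun (fun (j : Fin (n + 1)) => X j) μ := hXi.precomp Fin.val_injective
    rw [iIndepFun_iff_map_fun_eq_pi_map fun j : Fin (n + 1) => (hX j).aemeasurable] at h1
    rw [hZ, h1]
    congr 1
    funext j
    exact (hXd j).map_eq
  have hYZ : IndepFun Y Z μ := hYX.comp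
    (φ := id) (ψ := fun (x : ℕ → ℝ) (j : Fin (n + 1)) => x j)
    measurable_id (measurable_pi_lambda _ fun j => measurable_pi_apply _)
  have hlaw := (indepFun_iff_map_prod_eq_prod_map_map hY.aemeasurable hZm.aemeasurable).1 hYZ
  set E : Set (ℝ × (Fin (n + 1) → ℝ)) :=
    {p | |p.1 + ∑ j : Fin n, p.2 j.castSucc| ≤ M + |p.2 (Fin.last n)|} with hE
  have hEm : MeasurableSet E := measurableSet_le (by fun_prop) (by fun_prop)
  have hset : {ω | |Y ω + ∑ j ∈ Finset.range n, X j ω| ≤ M + |X n ω|} =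
      (fun ω => (Y ω, Z ω)) ⁻¹' E := by
    ext ω
    simp [hE, hZ, Finset.sum_range]
  have : IsProbabilityMeasure (μ.map Y) := Measure.isProbabilityMeasure_map hY.aemeasurable
  rw [hset, ← Measure.map_apply (hY.prodMk hZm) hEm, hlaw, hZlaw, Measure.prod_apply hEm]
  -- With the start frozen at `s`, the last of `n + 1` i.i.d. steps is split off as the independent
  -- `x` that sets the window.
  have hs : ∀ s, (Measure.pi fun _ : Fin (n + 1) => ν) (Prod.mk s ⁻¹' E) ≤
      ENNReal.ofReal (C / √((n : ℝ) + 1)) := by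
    intro s
    refine le_trans (le_of_eq ?_) (hC n s)
    set F : Set (ℝ × (Fin n → ℝ)) := {p | |s + ∑ j, p.2 j| ≤ M + |p.1|} with hF
    have hFm : MeasurableSet F := measurableSet_le (by fun_prop) (by fun_prop)
    have hmp := measurePreserving_piFinSuccAbove (fun _ : Fin (n + 1) => ν) (Fin.last n)
    have hpre : Prod.mk s ⁻¹' E =
        MeasurableEquiv.piFinSuccAbove (fun _ : Fin (n + 1) => ℝ) (Fin.last n) ⁻¹' F := by
      ext z
      simp [hE, hF, MeasurableEquiv.piFinSuccAbove, Fin.init]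
    rw [hpre, hmp.measure_preimage hFm.nullMeasurableSet, Measure.prod_apply hFm]
    rfl
  calc _ ≤ ∫⁻ _, ENNReal.ofReal (C / √((n : ℝ) + 1)) ∂(μ.map Y) := lintegral_mono hs
    _ = _ := by simp

/-- This replaces the geometric event by one condition per coordinate, so that independence of the
components can factor it. -/
theorem abs_apply_le_of_mem_segment {d : ℕ} {a b p : EuclideanSpace ℝ (Fin d)}
    (hp : p ∈ segment ℝ a b) (i : Fin d) : |a i| ≤ |p i| + |b i - a i| := by
  rw [segment_eq_image'] at hp
  obtain ⟨t, ht, rfl⟩ := hp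
  have e : a i = (a + t • (b - a)) i - t * (b i - a i) := by simp
  have h1 : |t * (b i - a i)| ≤ |b i - a i| := by
    rw [abs_mul, abs_of_nonneg ht.1]
    exact mul_le_of_le_one_left (abs_nonneg _) ht.2
  calc |a i| = |(a + t • (b - a)) i - t * (b i - a i)| := by rw [← e]
    _ ≤ _ := abs_sub _ _
    _ ≤ _ := by gcongr

theorem apply_eq_add_sum_increment {Ω : Type*} {d : ℕ}
    (S : ℕ → Ω → EuclideanSpace ℝ (Fin d)) (n : ℕ) (ω : Ω) (i : Fin d) :
    S n ω i = S 0 ω i + ∑ j ∈ Finset.range n, increment S j ω i := by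
  have h := Finset.sum_range_sub (fun j => S j ω i) n
  simp only [increment, PiLp.sub_apply]
  linarith

theorem IsRandomWalk.exists_measure_abs_apply_le {Ω : Type*} [MeasurableSpace Ω] {d : ℕ}
    {μ : Measure Ω} [IsProbabilityMeasure μ] {S : ℕ → Ω → EuclideanSpace ℝ (Fin d)}
    (hS : IsRandomWalk S μ) (i : Fin d)
    (hi : ∀ c, ¬ ∀ᵐ ω ∂μ, increment S 0 ω i = c) (M : ℝ) :
    ∃ C : ℝ, 0 ≤ C ∧ ∀ n : ℕ,
      μ {ω | |S n ω i| ≤ M + |S (n + 1) ω i - S n ω i|} ≤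
        ENNReal.ofReal (C / √((n : ℝ) + 1)) := by
  have hev : Measurable fun x : EuclideanSpace ℝ (Fin d) => x i := by fun_prop
  have h := exists_measure_abs_add_sum_le μ (Y := fun ω => S 0 ω i)
    (X := fun n ω => increment S n ω i) (hev.comp (hS.measurable 0))
    (fun n => hev.comp ((hS.measurable (n + 1)).sub (hS.measurable n)))
    (hS.iIndepFun_increment.comp (fun _ x => x i) fun _ => hev)
    (fun n => (hS.identDistrib_increment n).comp hev)
    (hS.indepFun_start.comp (φ := fun x : EuclideanSpace ℝ (Fin d) => x i)
      (ψ := fun (x : ℕ → EuclideanSpace ℝ (Fin d)) n => x n i) hev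
      (measurable_pi_lambda _ fun n => hev.comp (measurable_pi_apply n))) hi M
  simp only [← apply_eq_add_sum_increment] at h
  simpa only [increment, PiLp.sub_apply] using h

theorem IsRandomWalk.ae_eventually_lt_abs_apply {Ω : Type*} [MeasurableSpace Ω] {d : ℕ}
    {μ : Measure Ω} {S : ℕ → Ω → EuclideanSpace ℝ (Fin d)}
    (hS : IsRandomWalk S μ) (i : Fin d) {c : ℝ} (hc : c ≠ 0)
    (hi : ∀ᵐ ω ∂μ, increment S 0 ω i = c) (M : ℝ) :
    ∀ᵐ ω ∂μ, ∀ᶠ n in Filter.atTop, M + |S (n + 1) ω i - S n ω i| < |S n ω i| := by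
  have hev : Measurable fun x : EuclideanSpace ℝ (Fin d) => x i := by fun_prop
  have hall : ∀ᵐ ω ∂μ, ∀ n, increment S n ω i = c :=
    ae_all_iff.2 fun n => (hS.identDistrib_increment n).symm.ae_mem_snd
      (t := {x | x i = c}) (measurableSet_eq_fun hev measurable_const) hi
  filter_upwards [hall] with ω hω
  obtain ⟨N, hN⟩ := exists_nat_gt ((M + |c| + |S 0 ω i|) / |c|)
  filter_upwards [Filter.eventually_ge_atTop N] with n hn
  have hcpos : 0 < |c| := abs_pos.2 hc
  rw [div_lt_iff₀ hcpos] at hN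
  have h1 : S (n + 1) ω i - S n ω i = c := by simpa [increment] using hω n
  have h2 : S n ω i = S 0 ω i + n * c := by
    rw [apply_eq_add_sum_increment S n ω i]; simp [hω]
  have h3 : (N : ℝ) * |c| ≤ n * |c| := by gcongr
  have h4 : |(n : ℝ) * c| = n * |c| := by rw [abs_mul, Nat.abs_cast]
  have h5 := abs_sub_abs_le_abs_sub ((n : ℝ) * c) (-S 0 ω i)
  rw [abs_neg, sub_neg_eq_add, add_comm _ (S 0 ω i)] at h5
  rw [h1, h2]
  linarith

theorem ae_finite_hitTimes {Ω : Type*} [MeasurableSpace Ω] {μ : Measure Ω}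
    [IsProbabilityMeasure μ] {S : ℕ → Ω → EuclideanSpace ℝ (Fin 3)}
    (hS : IsRandomWalk S μ) (hcomp : IndepComponents S μ)
    (hnontrivial : ∀ i : Fin 3, ¬ ∀ᵐ ω ∂μ, increment S 0 ω i = 0)
    {B : Set (EuclideanSpace ℝ (Fin 3))} (hB : Bornology.IsBounded B) :
    ∀ᵐ ω ∂μ, (hitTimes S B ω).Finite := by
  obtain ⟨M, hM⟩ := hB.exists_norm_le
  have hhit : ∀ ω n, n ∈ hitTimes S B ω →
      ∀ i, |S n ω i| ≤ M + |S (n + 1) ω i - S n ω i| := by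
    rintro ω n ⟨p, hp, hpB⟩ i
    refine (abs_apply_le_of_mem_segment hp i).trans ?_
    gcongr
    exact (PiLp.norm_apply_le p i).trans (hM p hpB)
  have hfin : ∀ ω, (∀ᶠ n in Filter.atTop,
      ¬ ∀ i, |S n ω i| ≤ M + |S (n + 1) ω i - S n ω i|) → (hitTimes S B ω).Finite := by
    intro ω h
    by_contra hinf
    have hfreq : ∃ᶠ n in Filter.atTop, n ∈ hitTimes S B ω :=
      Nat.frequently_atTop_iff_infinite.2 hinf
    obtain ⟨n, hn1, hn2⟩ := (hfreq.and_eventually h).exists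
    exact hn2 (hhit ω n hn1)
  -- A constant coordinate has no spread for the concentration bound to use, but its drift alone
  -- escapes every bounded set.
  by_cases hconst : ∃ i c, ∀ᵐ ω ∂μ, increment S 0 ω i = c
  · obtain ⟨i, c, hi⟩ := hconst
    have hc : c ≠ 0 := by rintro rfl; exact hnontrivial i hi
    filter_upwards [hS.ae_eventually_lt_abs_apply i hc hi M] with ω hω
    refine hfin ω (hω.mono fun n hn hcon => ?_)
    exact absurd (hcon i) (not_le.2 hn)
  · simp only [not_exists] at hconst
    choose C hC0 hC using fun i => hS.exists_measure_abs_apply_le i (hconst i) M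
    set A : ℕ → Fin 3 → Set (ℕ → ℝ) := fun n _ => {x | |x n| ≤ M + |x (n + 1) - x n|} with hA
    have hAm : ∀ n i, MeasurableSet (A n i) := fun n i =>
      measurableSet_le (by fun_prop) (by fun_prop)
    set E : ℕ → Set Ω := fun n => {ω | ∀ i, |S n ω i| ≤ M + |S (n + 1) ω i - S n ω i|} with hE
    have hEle : ∀ n, μ (E n) ≤
        ENNReal.ofReal ((∏ i, C i) * (1 / ((n : ℝ) + 1) ^ (3 / 2 : ℝ))) := by
      intro n
      have h := hcomp.measure_inter_preimage_eq_mul (S := Finset.univ) (sets := A n)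
        fun i _ => hAm n i
      have hEeq : E n = ⋂ i ∈ (Finset.univ : Finset (Fin 3)),
          (fun ω m => S m ω i) ⁻¹' A n i := by
        ext ω
        simp [hE, hA]
      rw [hEeq, h]
      calc _ ≤ ∏ i, ENNReal.ofReal (C i / √((n : ℝ) + 1)) :=
            Finset.prod_le_prod' fun i _ => hC i n
        _ = _ := by
          rw [← ENNReal.ofReal_prod_of_nonneg fun i _ => div_nonneg (hC0 i) (Real.sqrt_nonneg _),
            Finset.prod_div_distrib, Finset.prod_const, Real.sqrt_eq_rpow, ← Real.rpow_natCast,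
            ← Real.rpow_mul (by positivity), div_eq_mul_one_div]
          norm_num
    have hsum : Summable fun n : ℕ => (∏ i, C i) * (1 / ((n : ℝ) + 1) ^ (3 / 2 : ℝ)) := by
      have h := (summable_nat_add_iff 1).2
        (Real.summable_one_div_nat_rpow.2 (show (1 : ℝ) < 3 / 2 by norm_num))
      push_cast at h
      exact h.mul_left _
    have hne : ∑' n, μ (E n) ≠ ⊤ :=
      ne_top_of_le_ne_top hsum.tsum_ofReal_ne_top (ENNReal.tsum_le_tsum hEle)
    filter_upwards [ae_eventually_notMem hne] with ω hω
    exact hfin ω hω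

end PolygonalWalk

theorem theorem1 {Ω : Type*} [MeasurableSpace Ω] (μ : Measure Ω) [IsProbabilityMeasure μ]
    (S : ℕ → Ω → EuclideanSpace ℝ (Fin 3))
    (hS : PolygonalWalk.IsRandomWalk S μ)
    (hcomp : PolygonalWalk.IndepComponents S μ)
    (hnontrivial : ∀ i : Fin 3, ¬ ∀ᵐ ω ∂μ, PolygonalWalk.increment S 0 ω i = 0) :
    PolygonalWalk.PolygonallyTransient S μ ∧
      ∀ B : Set (EuclideanSpace ℝ (Fin 3)), Bornology.IsBounded B →
        ∀ᵐ ω ∂μ, (PolygonalWalk.hitTimes S B ω).Finite := by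
  refine ⟨?_, fun B hB => PolygonalWalk.ae_finite_hitTimes hS hcomp hnontrivial hB⟩
  rintro ⟨B, hB, hinf⟩
  obtain ⟨ω, h1, h2⟩ :=
    (hinf.and (PolygonalWalk.ae_finite_hitTimes hS hcomp hnontrivial hB)).exists
  exact h1 h2
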